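/- All graphs are finite and simple. For a graph $G$, the degeneracy of $G$ is the smallest $d\in\mathbb N$ such that the vertices of $G$ can be ordered so that each vertex has at most $d$ neighbors among the preceding vertices. For $a\in\mathbb N$, the random $a$-fold cover $\mathcal H(G,a)=(L,H)$ of $G$ is obtained as follows: each vertex $v$ of $G$ gets the list $L(v)=\{(v,i): i\in[a]\}$; the vertex set of $H$ is the union of the lists, each list is independent in $H$, and independently for each edge $uv$ of $G$ the edges of $H$ between $L(u)$ and $L(v)$ form one of the $a!$ perfect matchings between $L(u)$ and $L(v)$, chosen uniformly at random; $H$ has no other edges. For $b\in\mathbb N$, a graph $G$ is $(\mathcal H(G,a),b)$-colorable if there is an independent set $T$ of $H$ with $|T\cap L(v)|=b$ for every vertex $v$ of $G$. For a real number $k\ge 1$ let $$p^*(G,k)=\sup\{\mathbb P(G\text{ is }(\mathcal H(G,a),b)\text{-colorable}) : a,b\in\mathbb N,\ b\ge 1,\ a/b\le k\}.$$ Theorem 1.8. For every $\epsilon>0$ there is $d_0\in\mathbb N$ such that, for every graph $G$ with degeneracy $d\ge d_0$ (and any number of vertices) and every real $k\ge (1+\epsilon)d/\ln d$, we have $p^*(G,k)\ge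 1-\epsilon$. -/

import Mathlib

open scoped Function

/-- `G` is `d`-degenerate: the vertices can be ordered so that each vertex has at most `d`
neighbours among the preceding vertices. -/
def IsDegenerate {V : Type*} [Fintype V] (G : SimpleGraph V) (d : ℕ) : Prop :=
  ∃ e : V ≃ Fin (Fintype.card V), ∀ v : V, {u : V | G.Adj u v ∧ e u < e v}.ncard ≤ d

/-- The degeneracy of a finite graph: the smallest `d` for which it is `d`-degenerate. -/
noncomputable def degeneracy {V : Type*} [Fintype V] (G : SimpleGraph V) : ℕ :=
  sInf {d : ℕ | IsDegenerate G d}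

/-- A DP-cover `(L, H)` of the graph `G`, where `H` is a graph on the vertex type `W`. -/
structure DPCover {V : Type*} (G : SimpleGraph V) (W : Type*) where
  /-- The cover graph `H`. -/
  graph : SimpleGraph W
  /-- The list `L v` of each vertex `v` of `G`. -/
  list : V → Set W
  /-- The lists partition the vertices of `H`. -/
  disjoint_list : Pairwise (Disjoint on list)
  iUnion_list : ⋃ v, list v = Set.univ
  /-- Each list is independent in `H`. -/
  indep_list : ∀ v, graph.IsIndepSet (list v)
  /-- The edges of `H` between the lists of adjacent vertices form a matching
  (the statement for the pair `v, u` gives uniqueness on the other side). -/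
  matching : ∀ u v, G.Adj u v → ∀ x ∈ list u, ∀ y ∈ list v, ∀ z ∈ list v,
    graph.Adj x y → graph.Adj x z → y = z
  /-- Every edge of `H` joins the lists of two adjacent vertices. -/
  adj_of_adj : ∀ u v, ∀ x ∈ list u, ∀ y ∈ list v, graph.Adj x y → G.Adj u v

namespace DPCover

variable {V : Type*} {G : SimpleGraph V} {W : Type*}

/-- A `k`-fold cover: all lists have exactly `k` elements. -/
def IsFold (C : DPCover G W) (k : ℕ) : Prop :=
  ∀ v, (C.list v).encard = k

/-- A `b`-fold transversal: a set meeting each list in exactly `b` elements. -/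
def IsTransversal (C : DPCover G W) (b : ℕ) (T : Set W) : Prop :=
  ∀ v, (C.list v ∩ T).encard = b

/-- `G` is `(C, b)`-colorable: the cover has an independent `b`-fold transversal. -/
def Colorable (C : DPCover G W) (b : ℕ) : Prop :=
  ∃ T : Set W, C.IsTransversal b T ∧ C.graph.IsIndepSet T

/-- The full `k`-fold cover of `G` given by one permutation of the `k` indices for each edge.
The lists are `{v} × [k]`, and an edge `uv` of `G` with `u < v` contributes the perfect matching
`{(u, i) (v, σ_{uv} i) : i ∈ [k]}`. The linear order is the enumeration of the vertices of `G`;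
it serves only to orient the edges. -/
def ofPerms [LinearOrder V] (G : SimpleGraph V) (k : ℕ) (σ : G.edgeSet → Equiv.Perm (Fin k)) :
    DPCover G (V × Fin k) where
  graph :=
    { Adj := fun x y =>
        (∃ h : G.Adj x.1 y.1, x.1 < y.1 ∧ σ ⟨s(x.1, y.1), h⟩ x.2 = y.2) ∨
        (∃ h : G.Adj y.1 x.1, y.1 < x.1 ∧ σ ⟨s(y.1, x.1), h⟩ y.2 = x.2)
      symm := ⟨fun _ _ h => h.symm⟩
      loopless := ⟨fun x h => by
        rcases h with ⟨h, -⟩ | ⟨h, -⟩ <;> exact G.irrefl h⟩ }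
  list v := {x | x.1 = v}
  disjoint_list := by
    intro u v huv
    refine Set.disjoint_left.2 ?_
    intro x hx hy
    exact huv (hx.symm.trans hy)
  iUnion_list := by
    ext x
    simp
  indep_list := by
    rintro v ⟨x, i⟩ hx ⟨y, j⟩ hy -
    simp only [Set.mem_ofPred_eq] at hx hy
    subst hx
    subst hy
    simp
  matching := by
    rintro u v - ⟨x, i⟩ hx ⟨y, j⟩ hy ⟨z, l⟩ hz h h'
    simp only [Set.mem_ofPred_eq] at hx hy hz
    subst hx hy hz
    rcases h with ⟨_, hlt, h⟩ | ⟨_, hlt, h⟩ <;> rcases h' with ⟨_, hlt', h'⟩ | ⟨_, hlt', h'⟩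
    · exact Prod.ext rfl (h.symm.trans h')
    · exact absurd hlt' hlt.asymm
    · exact absurd hlt' hlt.asymm
    · exact Prod.ext rfl ((Equiv.injective _) (h.trans h'.symm))
  adj_of_adj := by
    rintro u v ⟨x, i⟩ hx ⟨y, j⟩ hy h
    simp only [Set.mem_ofPred_eq] at hx hy
    subst hx hy
    rcases h with ⟨h, -⟩ | ⟨h, -⟩
    · exact h
    · exact h.symm

theorem ofPerms_isFold [LinearOrder V] (G : SimpleGraph V) (k : ℕ)
    (σ : G.edgeSet → Equiv.Perm (Fin k)) : (ofPerms G k σ).IsFold k := by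
  intro v
  have h : (ofPerms G k σ).list v = Set.range (fun i : Fin k => (v, i)) := by
    ext ⟨x, i⟩
    simp [ofPerms, eq_comm]
  rw [h, ← Set.image_univ, (Prod.mk_right_injective v).encard_image]
  simp

end DPCover

/-- The probability that `G` is `(C, b)`-colorable, where `C` is the random `a`-fold cover of `G`:
the permutations attached to the edges of `G` are independent and uniform, that is, all families
of permutations are equally likely. -/
noncomputable def probColorable {V : Type*} [Fintype V] [LinearOrder V] (G : SimpleGraph V)
    (a b : ℕ) : ℝ :=
  ({σ : G.edgeSet → Equiv.Perm (Fin a) | (DPCover.ofPerms G a σ).Colorable b}.ncard : ℝ) /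
    (Nat.card (G.edgeSet → Equiv.Perm (Fin a)) : ℝ)

/-- `p*(G, k)`: the supremum of the probabilities with which `G` is `(a, b)`-DP-colorable, over
all `a, b` with `b ≥ 1` and `a / b ≤ k`. -/
noncomputable def pStar {V : Type*} [Fintype V] [LinearOrder V] (G : SimpleGraph V)
    (k : ℝ) : ℝ :=
  sSup {p : ℝ | ∃ a b : ℕ, 0 < b ∧ (a : ℝ) / b ≤ k ∧ probColorable G a b = p}

/-! Fix a rational ratio x = a/b and colour greedily along a degeneracy order. When v is reached, at
most d earlier neighbours hold b-sets, and each random matching forbids a uniformly random b-set at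
v. The expected number of free colours is at least a(1 - 1/x)^d, which exceeds b by a linear amount
in a once 1/x < (1 - 1/x)^d. Negative correlation within each permutation bounds the variance by a
(`sum_sq_card_avoid_sub_le`), so Chebyshev gives a failure probability O(1/a) at v
(`card_extension_failure_le`).

A union bound over the vertices, with x fixed and a → ∞, makes the total failure probability vanish,
whatever the number of vertices: in fact p* = 1 (`one_le_pStar_of_isDegenerate`). For large d, some
x ≤ (1 + ε)d/ln d satisfies the inequality (`eventually_exists_rat`, `inv_lt_one_sub_inv_pow`). -/

/-! ### Moments for random permutations -/

open Finset in
theorem card_perm_apply_notMem {α : Type*} [Fintype α] [DecidableEq α] (B : Finset α) (x : α) :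
    (Fintype.card α : ℝ) * #{ρ : Equiv.Perm α | ρ x ∉ B} =
      (Fintype.card α - #B) * Fintype.card (Equiv.Perm α) := by
  have hconst : ∀ y, #{ρ : Equiv.Perm α | ρ y ∉ B} = #{ρ : Equiv.Perm α | ρ x ∉ B} := by
    intro y
    refine Finset.card_equiv (Equiv.mulRight (Equiv.swap x y)) fun ρ => ?_
    simp
  have hsum : ∑ y, #{ρ : Equiv.Perm α | ρ y ∉ B} = ∑ ρ : Equiv.Perm α, #{y | ρ y ∉ B} := by
    simp only [Finset.card_filter]
    exact Finset.sum_comm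
  have hcount : ∀ ρ : Equiv.Perm α, (#{y | ρ y ∉ B} : ℝ) = Fintype.card α - #B := by
    intro ρ
    have h1 : #{y | ρ y ∉ B} = #Bᶜ := Finset.card_equiv ρ fun y => by simp
    rw [h1, Finset.card_compl, Nat.cast_sub (Finset.card_le_univ B)]
  have h2 : (∑ y : α, (#{ρ : Equiv.Perm α | ρ y ∉ B} : ℝ)) =
      ∑ ρ : Equiv.Perm α, (#{y | ρ y ∉ B} : ℝ) := by exact_mod_cast hsum
  simp only [hconst, hcount, Finset.sum_const, nsmul_eq_mul, Finset.card_univ] at h2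
  rw [h2, mul_comm]

open Finset in
theorem card_perm_apply_notMem_pair {α : Type*} [Fintype α] [DecidableEq α] (B : Finset α)
    {x y : α} (hxy : x ≠ y) :
    ((Fintype.card α : ℝ) * (Fintype.card α - 1)) * #{ρ : Equiv.Perm α | ρ x ∉ B ∧ ρ y ∉ B} =
      ((Fintype.card α - #B) * (Fintype.card α - #B - 1)) * Fintype.card (Equiv.Perm α) := by
  have hconst : ∀ z ∈ (univ : Finset α).offDiag,
      #{ρ : Equiv.Perm α | ρ z.1 ∉ B ∧ ρ z.2 ∉ B} = #{ρ : Equiv.Perm α | ρ x ∉ B ∧ ρ y ∉ B} := by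
    rintro ⟨x', y'⟩ hz
    have hz' : x' ≠ y' := by simpa using hz
    -- Double transitivity: the second swap corrects the image of y and fixes x'.
    obtain ⟨g, hg1, hg2⟩ : ∃ g : Equiv.Perm α, g x = x' ∧ g y = y' := by
      refine ⟨Equiv.swap (Equiv.swap x x' y) y' * Equiv.swap x x', ?_, ?_⟩
      · have h1 : x' ≠ Equiv.swap x x' y := by
          intro h
          apply hxy
          have := congrArg (Equiv.swap x x') h
          simpa using this
        simp [Equiv.swap_apply_of_ne_of_ne h1 hz']
      · simp
    refine Finset.card_equiv (Equiv.mulRight g) fun ρ => ?_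
    simp [hg1, hg2]
  have hsum : ∑ z ∈ (univ : Finset α).offDiag, #{ρ : Equiv.Perm α | ρ z.1 ∉ B ∧ ρ z.2 ∉ B} =
      ∑ ρ : Equiv.Perm α, #{z ∈ (univ : Finset α).offDiag | ρ z.1 ∉ B ∧ ρ z.2 ∉ B} := by
    simp only [Finset.card_filter]
    exact Finset.sum_comm
  have hoff : ∀ S : Finset α, (#S.offDiag : ℝ) = #S * (#S - 1) := by
    intro S
    rw [Finset.offDiag_card, Nat.cast_sub (Nat.le_mul_self _)]
    push_cast
    ring
  have hcount : ∀ ρ : Equiv.Perm α,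
      (#{z ∈ (univ : Finset α).offDiag | ρ z.1 ∉ B ∧ ρ z.2 ∉ B} : ℝ) =
        (Fintype.card α - #B) * (Fintype.card α - #B - 1) := by
    intro ρ
    have h1 : #{z ∈ (univ : Finset α).offDiag | ρ z.1 ∉ B ∧ ρ z.2 ∉ B} = #(Bᶜ).offDiag :=
      Finset.card_equiv (ρ.prodCongr ρ) fun z => by
        simp only [mem_filter, mem_offDiag, mem_univ, true_and, Equiv.prodCongr_apply, mem_compl,
          Prod.map_fst, Prod.map_snd, ne_eq, EmbeddingLike.apply_eq_iff_eq]
        tauto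
    rw [h1, hoff, Finset.card_compl, Nat.cast_sub (Finset.card_le_univ B)]
  have h2 : (∑ z ∈ (univ : Finset α).offDiag,
      (#{ρ : Equiv.Perm α | ρ z.1 ∉ B ∧ ρ z.2 ∉ B} : ℝ)) =
      ∑ ρ : Equiv.Perm α, (#{z ∈ (univ : Finset α).offDiag | ρ z.1 ∉ B ∧ ρ z.2 ∉ B} : ℝ) := by
    exact_mod_cast hsum
  rw [Finset.sum_congr rfl fun z hz => by rw [hconst z hz]] at h2
  simp only [hcount, Finset.sum_const, nsmul_eq_mul, Finset.card_univ, hoff] at h2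
  rw [h2, mul_comm]

open Finset in
/-- The events `ρ x ∉ B` and `ρ y ∉ B` are negatively correlated for a random permutation `ρ`. -/
theorem card_perm_apply_notMem_pair_le {α : Type*} [Fintype α] [DecidableEq α] (B : Finset α)
    {x y : α} (hxy : x ≠ y) :
    (#{ρ : Equiv.Perm α | ρ x ∉ B ∧ ρ y ∉ B} : ℝ) ≤
      ((Fintype.card α - #B) / Fintype.card α : ℝ) ^ 2 * Fintype.card (Equiv.Perm α) := by
  have h := card_perm_apply_notMem_pair B hxy
  have ha : (2 : ℝ) ≤ Fintype.card α := by
    exact_mod_cast Fintype.one_lt_card_iff.2 ⟨x, y, hxy⟩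
  have hB : (#B : ℝ) ≤ Fintype.card α := by exact_mod_cast Finset.card_le_univ B
  have hB0 : (0 : ℝ) ≤ #B := by positivity
  have hM : (0 : ℝ) ≤ Fintype.card (Equiv.Perm α) := by positivity
  generalize (#{ρ : Equiv.Perm α | ρ x ∉ B ∧ ρ y ∉ B} : ℝ) = c at *
  generalize (Fintype.card (Equiv.Perm α) : ℝ) = M at *
  generalize (Fintype.card α : ℝ) = a at *
  generalize (#B : ℝ) = b at *
  have hpos : 0 < a * (a - 1) := by nlinarith
  rw [← mul_le_mul_iff_right₀ hpos, h, ← mul_assoc]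
  refine mul_le_mul_of_nonneg_right ?_ hM
  have : a * (a - 1) * ((a - b) / a) ^ 2 = (a - b) * ((a - 1) * (a - b) / a) := by
    field_simp
  rw [this]
  refine mul_le_mul_of_nonneg_left ?_ (by linarith)
  -- With denominators cleared, the claim reduces to 0 ≤ b.
  rw [le_div_iff₀ (by linarith)]
  nlinarith

open Finset in
theorem card_pi_forall {ι β : Type*} [Fintype ι] [DecidableEq ι] [Fintype β]
    (P : ι → β → Prop) [∀ i, DecidablePred (P i)] :
    #{ρ : ι → β | ∀ i, P i (ρ i)} = ∏ i, #{r | P i r} := by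
  rw [← Fintype.card_piFinset]
  congr 1
  ext ρ
  simp

open Finset in
/-- Second moment bound for the number of points avoiding all the sets `(ρ i)⁻¹ (B i)`, where the
`ρ i` are independent uniform permutations. -/
theorem sum_sq_card_avoid_sub_le {α ι : Type*} [Fintype α] [DecidableEq α] [Nonempty α]
    [Fintype ι] [DecidableEq ι] (B : ι → Finset α) {b : ℕ} (hB : ∀ i, #(B i) = b) :
    ∑ ρ : ι → Equiv.Perm α, ((#{x | ∀ i, ρ i x ∉ B i} : ℝ) -
        Fintype.card α * ((Fintype.card α - b) / Fintype.card α : ℝ) ^ Fintype.card ι) ^ 2 ≤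
      Fintype.card α * Fintype.card (ι → Equiv.Perm α) := by
  set a : ℝ := (Fintype.card α : ℝ) with ha
  have ha0 : 0 < a := by rw [ha]; exact_mod_cast Fintype.card_pos
  set q : ℝ := (a - b) / a with hq
  set m := Fintype.card ι with hm
  set K : ℝ := (Fintype.card (ι → Equiv.Perm α) : ℝ) with hK
  have hKM : K = (Fintype.card (Equiv.Perm α) : ℝ) ^ m := by
    rw [hK, Fintype.card_fun]; push_cast; rfl
  have hone : ∀ x : α, (#{ρ : ι → Equiv.Perm α | ∀ i, ρ i x ∉ B i} : ℝ) = q ^ m * K := by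
    intro x
    rw [card_pi_forall (fun i (r : Equiv.Perm α) => r x ∉ B i), hKM, ← mul_pow]
    push_cast
    rw [hm, ← Finset.card_univ (α := ι), ← Finset.prod_const]
    refine Finset.prod_congr rfl fun i _ => ?_
    have h := card_perm_apply_notMem (B i) x
    rw [hB, ← ha] at h
    rw [hq]
    field_simp
    linarith
  have htwo : ∀ x y : α, x ≠ y →
      (#{ρ : ι → Equiv.Perm α | (∀ i, ρ i x ∉ B i) ∧ ∀ i, ρ i y ∉ B i} : ℝ) ≤
        (q ^ m) ^ 2 * K := by
    intro x y hxy
    simp only [← forall_and]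
    rw [card_pi_forall (fun i (r : Equiv.Perm α) => r x ∉ B i ∧ r y ∉ B i), hKM, ← pow_mul, mul_comm m, pow_mul,
      ← mul_pow]
    push_cast
    rw [hm, ← Finset.card_univ (α := ι), ← Finset.prod_const]
    refine Finset.prod_le_prod (fun i _ => by positivity) fun i _ => ?_
    have h := card_perm_apply_notMem_pair_le (B i) hxy
    rwa [hB] at h
  have hfirst : ∑ ρ : ι → Equiv.Perm α, (#{x | ∀ i, ρ i x ∉ B i} : ℝ) = a * q ^ m * K := by
    have h : ∑ ρ : ι → Equiv.Perm α, #{x | ∀ i, ρ i x ∉ B i} =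
        ∑ x, #{ρ : ι → Equiv.Perm α | ∀ i, ρ i x ∉ B i} := by
      simp only [Finset.card_filter]
      exact Finset.sum_comm
    have h' : ∑ ρ : ι → Equiv.Perm α, (#{x | ∀ i, ρ i x ∉ B i} : ℝ) =
        ∑ x, (#{ρ : ι → Equiv.Perm α | ∀ i, ρ i x ∉ B i} : ℝ) := by exact_mod_cast h
    rw [h']
    simp only [hone, Finset.sum_const, nsmul_eq_mul, Finset.card_univ, ← ha, mul_assoc]
  have hsecond : ∑ ρ : ι → Equiv.Perm α, (#{x | ∀ i, ρ i x ∉ B i} : ℝ) ^ 2 ≤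
      a * K + (a * q ^ m) ^ 2 * K := by
    have h : ∑ ρ : ι → Equiv.Perm α, #{x | ∀ i, ρ i x ∉ B i} ^ 2 =
        ∑ x, ∑ y, #{ρ : ι → Equiv.Perm α | (∀ i, ρ i x ∉ B i) ∧ ∀ i, ρ i y ∉ B i} := by
      simp only [Finset.card_filter, sq, Finset.sum_mul_sum]
      rw [Finset.sum_comm]
      refine Finset.sum_congr rfl fun x _ => ?_
      rw [Finset.sum_comm]
      refine Finset.sum_congr rfl fun y _ => Finset.sum_congr rfl fun ρ _ => ?_
      rw [ite_and]
      split_ifs <;> simp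
    have h' : ∑ ρ : ι → Equiv.Perm α, (#{x | ∀ i, ρ i x ∉ B i} : ℝ) ^ 2 = ∑ x, ∑ y,
        (#{ρ : ι → Equiv.Perm α | (∀ i, ρ i x ∉ B i) ∧ ∀ i, ρ i y ∉ B i} : ℝ) := by
      exact_mod_cast h
    rw [h']
    have hK0 : 0 ≤ K := by positivity
    -- Each of the a diagonal pairs costs at most K; these alone produce the variance bound a.
    calc _ ≤ ∑ x : α, ∑ y : α, ((if x = y then K else 0) + (q ^ m) ^ 2 * K) := by
          refine Finset.sum_le_sum fun x _ => Finset.sum_le_sum fun y _ => ?_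
          split_ifs with hxy
          · have : (#{ρ : ι → Equiv.Perm α | (∀ i, ρ i x ∉ B i) ∧ ∀ i, ρ i y ∉ B i} : ℝ) ≤ K := by
              rw [hK]; exact_mod_cast Finset.card_le_univ _
            have h2 : 0 ≤ (q ^ m) ^ 2 * K := by positivity
            linarith
          · rw [zero_add]
            exact htwo x y hxy
      _ = _ := by
          simp only [Finset.sum_add_distrib, Finset.sum_ite_eq, Finset.mem_univ, if_true,
            Finset.sum_const, nsmul_eq_mul, Finset.card_univ, ← ha]
          ring
  have hexp : ∑ ρ : ι → Equiv.Perm α, ((#{x | ∀ i, ρ i x ∉ B i} : ℝ) - a * q ^ m) ^ 2 =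
      ∑ ρ : ι → Equiv.Perm α, (#{x | ∀ i, ρ i x ∉ B i} : ℝ) ^ 2 -
        2 * (a * q ^ m) * ∑ ρ : ι → Equiv.Perm α, (#{x | ∀ i, ρ i x ∉ B i} : ℝ) +
        (a * q ^ m) ^ 2 * K := by
    simp only [sub_sq, Finset.sum_add_distrib, Finset.sum_sub_distrib, Finset.mul_sum,
      Finset.sum_const, nsmul_eq_mul, Finset.card_univ, ← hK]
    congr 1
    · congr 1
      exact Finset.sum_congr rfl fun ρ _ => by ring
    · ring
  rw [hexp, hfirst]
  nlinarith [hsecond]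

open Finset in
/-- Chebyshev's inequality for the number of points avoiding random sets of size `b`. -/
theorem card_avoid_lt_le {α ι : Type*} [Fintype α] [DecidableEq α] [Nonempty α]
    [Fintype ι] [DecidableEq ι] (B : ι → Finset α) {b d : ℕ} (hB : ∀ i, #(B i) = b)
    (hd : Fintype.card ι ≤ d) (hba : b ≤ Fintype.card α)
    (hgap : (b : ℝ) ≤ Fintype.card α * ((Fintype.card α - b) / Fintype.card α : ℝ) ^ d) :
    (#{ρ : ι → Equiv.Perm α | #{x | ∀ i, ρ i x ∉ B i} < b} : ℝ) *
        (Fintype.card α * ((Fintype.card α - b) / Fintype.card α : ℝ) ^ d - b) ^ 2 ≤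
      Fintype.card α * Fintype.card (ι → Equiv.Perm α) := by
  refine le_trans ?_ (sum_sq_card_avoid_sub_le B hB)
  rw [← nsmul_eq_mul, ← Finset.sum_const]
  refine le_trans ?_ (Finset.sum_le_sum_of_subset_of_nonneg
    (Finset.filter_subset (fun ρ : ι → Equiv.Perm α => #{x | ∀ i, ρ i x ∉ B i} < b) _)
    fun _ _ _ => sq_nonneg _)
  refine Finset.sum_le_sum fun ρ hρ => ?_
  have hlt : (#{x | ∀ i, ρ i x ∉ B i} : ℝ) < b := by exact_mod_cast (Finset.mem_filter.1 hρ).2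
  have ha0 : (0 : ℝ) < Fintype.card α := by exact_mod_cast Fintype.card_pos
  have hbR : (b : ℝ) ≤ Fintype.card α := by exact_mod_cast hba
  have hq0 : 0 ≤ ((Fintype.card α - b) / Fintype.card α : ℝ) :=
    div_nonneg (by linarith) ha0.le
  have hq1 : ((Fintype.card α - b) / Fintype.card α : ℝ) ≤ 1 := by
    rw [div_le_one ha0]
    have : (0 : ℝ) ≤ b := by positivity
    linarith
  have hpow := mul_le_mul_of_nonneg_left (pow_le_pow_of_le_one hq0 hq1 hd) ha0.le
  rw [sub_sq_comm (#{x | ∀ i, ρ i x ∉ B i} : ℝ)]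
  exact pow_le_pow_left₀ (by linarith) (by linarith) 2

-- Inverting some of the permutations preserves uniformity, so the orientation of the edges is
-- immaterial.
open Finset in
theorem card_avoid_equiv_lt_le {α ι : Type*} [Fintype α] [DecidableEq α] [Nonempty α]
    [Fintype ι] [DecidableEq ι] (f : ι → Equiv.Perm α ≃ Equiv.Perm α) (B : ι → Finset α)
    {b d : ℕ} (hB : ∀ i, #(B i) = b)
    (hd : Fintype.card ι ≤ d) (hba : b ≤ Fintype.card α)
    (hgap : (b : ℝ) ≤ Fintype.card α * ((Fintype.card α - b) / Fintype.card α : ℝ) ^ d) :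
    (#{ρ : ι → Equiv.Perm α | #{x | ∀ i, f i (ρ i) x ∉ B i} < b} : ℝ) *
        (Fintype.card α * ((Fintype.card α - b) / Fintype.card α : ℝ) ^ d - b) ^ 2 ≤
      Fintype.card α * Fintype.card (ι → Equiv.Perm α) := by
  have h : #{ρ : ι → Equiv.Perm α | #{x | ∀ i, f i (ρ i) x ∉ B i} < b} =
      #{ρ : ι → Equiv.Perm α | #{x | ∀ i, ρ i x ∉ B i} < b} :=
    Finset.card_equiv (Equiv.piCongrRight f) fun ρ => by simp
  rw [h]
  exact card_avoid_lt_le B hB hd hba hgap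

/-! ### Conditioning, and orientation of edges -/

open Finset in
/-- A bound on all fibres of a restriction map gives a bound on the whole set. -/
theorem card_le_of_fiber_le {E β : Type*} [Fintype E] [DecidableEq E] [Fintype β]
    (p : E → Prop) [DecidablePred p] (S : (E → β) → Prop) [DecidablePred S] {δ : ℝ}
    (h : ∀ τ : {x // ¬ p x} → β,
      (#{ρ : {x // p x} → β | S ((Equiv.piEquivPiSubtypeProd p fun _ => β).symm (ρ, τ))} : ℝ) ≤
        δ * Fintype.card ({x // p x} → β)) :
    (#{σ | S σ} : ℝ) ≤ δ * Fintype.card (E → β) := by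
  have h1 : #{σ | S σ} = ∑ τ : {x // ¬ p x} → β,
      #{ρ : {x // p x} → β | S ((Equiv.piEquivPiSubtypeProd p fun _ => β).symm (ρ, τ))} := by
    simp only [Finset.card_filter]
    rw [← Finset.sum_product_right' (f := fun ρ τ =>
      if S ((Equiv.piEquivPiSubtypeProd p fun _ => β).symm (ρ, τ)) then 1 else 0),
      Finset.univ_product_univ]
    exact (Equiv.sum_comp (Equiv.piEquivPiSubtypeProd p fun _ => β).symm _).symm
  rw [h1, Fintype.card_congr (Equiv.piEquivPiSubtypeProd p fun _ => β), Fintype.card_prod]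
  push_cast
  calc _ ≤ ∑ _τ : {x // ¬ p x} → β, δ * Fintype.card ({x // p x} → β) :=
        Finset.sum_le_sum fun τ _ => h τ
    _ = _ := by
        rw [Finset.sum_const, nsmul_eq_mul, Finset.card_univ]
        ring

/-- The permutation of an edge, oriented from `v` to `u`. -/
def orientPerm {V : Type*} [LinearOrder V] {a : ℕ} (u v : V) : Equiv.Perm (Fin a) ≃ Equiv.Perm (Fin a) :=
  if u < v then Equiv.inv _ else Equiv.refl _

theorem ofPerms_adj_iff {V : Type*} [LinearOrder V] {G : SimpleGraph V} {a : ℕ}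
    (σ : G.edgeSet → Equiv.Perm (Fin a)) {u v : V} (h : G.Adj u v)
    (x y : Fin a) : (DPCover.ofPerms G a σ).graph.Adj (u, x) (v, y) ↔
      orientPerm u v (σ ⟨s(u, v), h⟩) y = x := by
  rcases lt_or_gt_of_ne h.ne with hlt | hlt
  · simp only [DPCover.ofPerms, orientPerm, hlt, hlt.not_gt, h, if_true, Equiv.inv_apply,
      Equiv.Perm.inv_eq_iff_eq, exists_true_left, true_and, false_and, exists_prop, and_false,
      or_false]
    exact eq_comm
  · have : (⟨s(v, u), h.symm⟩ : G.edgeSet) = ⟨s(u, v), h⟩ := Subtype.ext Sym2.eq_swap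
    simp [DPCover.ofPerms, orientPerm, hlt, hlt.not_gt, h.symm, this]

/-! ### Greedy colouring along the degeneracy order -/

section Greedy

variable {V : Type*} [Fintype V] [LinearOrder V] {G : SimpleGraph V} {a : ℕ}

/-- `T` selects `b` colours at each vertex, without conflicts among the first `i` vertices. -/
def IsPartialColoring (e : V ≃ Fin (Fintype.card V)) (b i : ℕ)
    (σ : G.edgeSet → Equiv.Perm (Fin a)) (T : V → Finset (Fin a)) : Prop :=
  (∀ v, (T v).card = b) ∧ ∀ u v, (e u : ℕ) < i → (e v : ℕ) < i → ∀ x ∈ T u, ∀ y ∈ T v,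
    ¬ (DPCover.ofPerms G a σ).graph.Adj (u, x) (v, y)

theorem IsPartialColoring.colorable {e : V ≃ Fin (Fintype.card V)} {b : ℕ}
    {σ : G.edgeSet → Equiv.Perm (Fin a)} {T : V → Finset (Fin a)}
    (hT : IsPartialColoring e b (Fintype.card V) σ T) :
    (DPCover.ofPerms G a σ).Colorable b := by
  refine ⟨{p | p.2 ∈ T p.1}, fun v => ?_, ?_⟩
  · have h : (DPCover.ofPerms G a σ).list v ∩ {p | p.2 ∈ T p.1} = (fun i => (v, i)) '' (T v) := by
      ext ⟨x, i⟩
      simp only [DPCover.ofPerms, Set.mem_inter_iff, Set.mem_ofPred_eq, Set.mem_image,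
        Finset.mem_coe, Prod.mk.injEq]
      constructor
      · rintro ⟨rfl, h⟩
        exact ⟨i, h, rfl, rfl⟩
      · rintro ⟨j, hj, rfl, rfl⟩
        exact ⟨rfl, hj⟩
    rw [h, (Prod.mk_right_injective v).encard_image, Set.encard_coe_eq_coe_finsetCard, hT.1]
  · rintro ⟨u, x⟩ hx ⟨v, y⟩ hy -
    exact hT.2 u v (e u).2 (e v).2 x hx y hy

open Finset Classical in
/-- One step of the greedy procedure: few covers allow a partial colouring of the first `i`
vertices but none of the first `i + 1`. -/
theorem card_extension_failure_le (e : V ≃ Fin (Fintype.card V)) {b d : ℕ} (ha : 0 < a)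
    (hdeg : ∀ v : V, {u : V | G.Adj u v ∧ e u < e v}.ncard ≤ d) (hba : b ≤ a)
    (hgap : (b : ℝ) < a * ((a - b) / a : ℝ) ^ d) (v : V) :
    (#{σ : G.edgeSet → Equiv.Perm (Fin a) | (∃ T, IsPartialColoring e b (e v) σ T) ∧
        ¬ ∃ T, IsPartialColoring e b (e v + 1) σ T} : ℝ) ≤
      (a / (a * ((a - b) / a : ℝ) ^ d - b) ^ 2) *
        Fintype.card (G.edgeSet → Equiv.Perm (Fin a)) := by
  have : Nonempty (Fin a) := ⟨⟨0, ha⟩⟩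
  -- The edges from v back to earlier vertices stay random; all others are frozen as τ.
  let p : G.edgeSet → Prop := fun x => ∃ u, e u < e v ∧ x.1 = s(u, v)
  refine card_le_of_fiber_le p _ fun τ => ?_
  set glue : ({x // p x} → Equiv.Perm (Fin a)) → G.edgeSet → Equiv.Perm (Fin a) :=
    fun ρ => (Equiv.piEquivPiSubtypeProd p fun _ => Equiv.Perm (Fin a)).symm (ρ, τ) with hglue
  have hpos : 0 < (a * ((a - b) / a : ℝ) ^ d - b) ^ 2 := pow_pos (sub_pos.2 hgap) 2
  have hglue_pos : ∀ ρ x (hx : p x), glue ρ x = ρ ⟨x, hx⟩ := by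
    intro ρ x hx
    simp [hglue, Equiv.piEquivPiSubtypeProd, hx]
  have hglue_neg : ∀ ρ x (hx : ¬ p x), glue ρ x = τ ⟨x, hx⟩ := by
    intro ρ x hx
    simp [hglue, Equiv.piEquivPiSubtypeProd, hx]
  by_cases hτ : ∃ ρ T, IsPartialColoring e b (e v) (glue ρ) T
  swap
  · have : #{ρ : {x // p x} → Equiv.Perm (Fin a) |
        (∃ T, IsPartialColoring e b (e v) (glue ρ) T) ∧
          ¬ ∃ T, IsPartialColoring e b (e v + 1) (glue ρ) T} = 0 := by
      rw [Finset.card_eq_zero, Finset.filter_eq_empty_iff]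
      rintro ρ - ⟨⟨T, hT⟩, -⟩
      exact hτ ⟨ρ, T, hT⟩
    rw [this]
    push_cast
    positivity
  -- T is chosen once for the whole fibre, so it is independent of ρ. It stays valid for every ρ
  -- because edges in p contain v and never join two vertices before v.
  obtain ⟨ρ₀, T, hT⟩ := hτ
  have hTρ : ∀ ρ, IsPartialColoring e b (e v) (glue ρ) T := by
    refine fun ρ => ⟨hT.1, fun u w hu hw x hx y hy hadj => hT.2 u w hu hw x hx y hy ?_⟩
    have huw : G.Adj u w := (DPCover.ofPerms G a (glue ρ)).adj_of_adj u w (u, x) rfl (w, y) rfl hadj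
    have hnp : ¬ p ⟨s(u, w), huw⟩ := by
      rintro ⟨z, -, hz⟩
      have hv : v ∈ s(u, w) := by
        have hz' : s(u, w) = s(z, v) := hz
        rw [hz']
        exact Sym2.mem_mk_right z v
      rcases Sym2.mem_iff.1 hv with rfl | rfl
      · exact lt_irrefl _ hu
      · exact lt_irrefl _ hw
    rw [ofPerms_adj_iff _ huw, hglue_neg _ _ hnp] at hadj ⊢
    exact hadj
  choose nb hnb_lt hnb_eq using fun x : {x // p x} => x.2
  have hcard : Fintype.card {x // p x} ≤ d := by
    refine le_trans ?_ (hdeg v)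
    rw [← Nat.card_eq_fintype_card, ← Set.ncard_univ]
    refine Set.ncard_le_ncard_of_injOn nb (fun x _ => ⟨?_, hnb_lt x⟩) ?_
    · have h := x.1.2
      rw [hnb_eq x] at h
      exact h
    · intro x _ y _ hxy
      apply Subtype.ext
      apply Subtype.ext
      rw [hnb_eq x, hnb_eq y, hxy]
  have hmain := card_avoid_equiv_lt_le (α := Fin a) (ι := {x // p x})
    (fun x => orientPerm (nb x) v) (fun x => T (nb x)) (b := b) (d := d) (fun x => hT.1 _) hcard
    (by simpa using hba) (by simpa using hgap.le)
  rw [Fintype.card_fin] at hmain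
  rw [div_mul_eq_mul_div, le_div_iff₀ hpos]
  refine le_trans (mul_le_mul_of_nonneg_right ?_ hpos.le) hmain
  rw [Nat.cast_le]
  refine Finset.card_le_card fun ρ hρ => ?_
  simp only [Finset.mem_filter, Finset.mem_univ, true_and] at hρ ⊢
  by_contra hge
  rw [not_lt] at hge
  -- If at least b colours survive at v, any b of them extend T.
  obtain ⟨S, hS, hSb⟩ := Finset.exists_subset_card_eq hge
  refine hρ.2 ⟨Function.update T v S, ?_, ?_⟩
  · intro w
    by_cases hw : w = v
    · subst hw; simpa using hSb
    · simpa [hw] using hT.1 w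
  have hnew : ∀ u, (e u : ℕ) < e v → ∀ x ∈ T u, ∀ y ∈ S,
      ¬ (DPCover.ofPerms G a (glue ρ)).graph.Adj (u, x) (v, y) := by
    intro u hu x hx y hy hadj
    have huv : G.Adj u v := (DPCover.ofPerms G a (glue ρ)).adj_of_adj u v (u, x) rfl (v, y) rfl hadj
    have hp : p ⟨s(u, v), huv⟩ := ⟨u, hu, rfl⟩
    have hnb : nb ⟨_, hp⟩ = u := by
      have := hnb_eq ⟨_, hp⟩
      exact (Sym2.congr_left.1 this).symm
    rw [ofPerms_adj_iff _ huv, hglue_pos _ _ hp] at hadj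
    have := (Finset.mem_filter.1 (hS hy)).2 ⟨_, hp⟩
    rw [hnb, hadj] at this
    exact this hx
  intro u w hu hw x hx y hy
  by_cases huv : u = v
  · by_cases hwv : w = v
    · subst huv hwv
      intro hadj
      exact G.irrefl ((DPCover.ofPerms G a (glue ρ)).adj_of_adj w w (w, x) rfl (w, y) rfl hadj)
    · subst huv
      have hw' : (e w : ℕ) < e u :=
        lt_of_le_of_ne (Nat.lt_succ_iff.1 hw) fun h => hwv (e.injective (Fin.ext h))
      rw [Function.update_self] at hx
      rw [Function.update_of_ne hwv] at hy
      exact fun hadj => hnew w hw' y hy x hx hadj.symm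
  · have hu' : (e u : ℕ) < e v :=
      lt_of_le_of_ne (Nat.lt_succ_iff.1 hu) fun h => huv (e.injective (Fin.ext h))
    rw [Function.update_of_ne huv] at hx
    by_cases hwv : w = v
    · subst hwv
      rw [Function.update_self] at hy
      exact hnew u hu' x hx y hy
    · have hw' : (e w : ℕ) < e v :=
        lt_of_le_of_ne (Nat.lt_succ_iff.1 hw) fun h => hwv (e.injective (Fin.ext h))
      rw [Function.update_of_ne hwv] at hy
      exact (hTρ ρ).2 u w hu' hw' x hx y hy

-- Union bound: a failure at i + 1 is a failure at i or a failure of the new step.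
open Finset Classical in
theorem card_not_partialColoring_le (e : V ≃ Fin (Fintype.card V)) {b d : ℕ} (ha : 0 < a)
    (hdeg : ∀ v : V, {u : V | G.Adj u v ∧ e u < e v}.ncard ≤ d) (hba : b ≤ a)
    (hgap : (b : ℝ) < a * ((a - b) / a : ℝ) ^ d) {i : ℕ} (hi : i ≤ Fintype.card V) :
    (#{σ : G.edgeSet → Equiv.Perm (Fin a) | ¬ ∃ T, IsPartialColoring e b i σ T} : ℝ) ≤
      i * ((a / (a * ((a - b) / a : ℝ) ^ d - b) ^ 2) *
        Fintype.card (G.edgeSet → Equiv.Perm (Fin a))) := by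
  induction i with
  | zero =>
    have : #{σ : G.edgeSet → Equiv.Perm (Fin a) | ¬ ∃ T, IsPartialColoring e b 0 σ T} = 0 := by
      rw [Finset.card_eq_zero, Finset.filter_eq_empty_iff]
      obtain ⟨S, -, hS⟩ := Finset.exists_subset_card_eq (s := (univ : Finset (Fin a))) (n := b)
        (by simpa using hba)
      exact fun σ _ h => h ⟨fun _ => S, fun _ => hS, fun u v hu => absurd hu (Nat.not_lt_zero _)⟩
    rw [this]
    simp
  | succ i ih =>
    have hstep := card_extension_failure_le (G := G) e ha hdeg hba hgap (e.symm ⟨i, hi⟩)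
    simp only [Equiv.apply_symm_apply] at hstep
    have hih := ih (Nat.le_of_succ_le hi)
    have hsub : #{σ : G.edgeSet → Equiv.Perm (Fin a) | ¬ ∃ T, IsPartialColoring e b (i + 1) σ T} ≤
        #{σ : G.edgeSet → Equiv.Perm (Fin a) | ¬ ∃ T, IsPartialColoring e b i σ T} +
        #{σ : G.edgeSet → Equiv.Perm (Fin a) | (∃ T, IsPartialColoring e b i σ T) ∧
          ¬ ∃ T, IsPartialColoring e b (i + 1) σ T} := by
      refine le_trans (Finset.card_le_card fun σ hσ => ?_) (Finset.card_union_le _ _)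
      simp only [Finset.mem_union, Finset.mem_filter, Finset.mem_univ, true_and] at hσ ⊢
      tauto
    have hsub' : (#{σ : G.edgeSet → Equiv.Perm (Fin a) |
        ¬ ∃ T, IsPartialColoring e b (i + 1) σ T} : ℝ) ≤
        #{σ : G.edgeSet → Equiv.Perm (Fin a) | ¬ ∃ T, IsPartialColoring e b i σ T} +
        #{σ : G.edgeSet → Equiv.Perm (Fin a) | (∃ T, IsPartialColoring e b i σ T) ∧
          ¬ ∃ T, IsPartialColoring e b (i + 1) σ T} := by exact_mod_cast hsub
    push_cast
    linarith

theorem one_sub_le_probColorable {b d : ℕ} (ha : 0 < a) (hG : IsDegenerate G d) (hba : b ≤ a)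
    (hgap : (b : ℝ) < a * ((a - b) / a : ℝ) ^ d) :
    1 - Fintype.card V * (a / (a * ((a - b) / a : ℝ) ^ d - b) ^ 2) ≤ probColorable G a b := by
  classical
  obtain ⟨e, he⟩ := hG
  have h := card_not_partialColoring_le (G := G) e ha he hba hgap le_rfl
  rw [probColorable, Nat.card_eq_fintype_card, le_div_iff₀ (by exact_mod_cast Fintype.card_pos)]
  have hsub : (Finset.univ.filter fun σ : G.edgeSet → Equiv.Perm (Fin a) =>
      ∃ T, IsPartialColoring e b (Fintype.card V) σ T).card ≤
      {σ : G.edgeSet → Equiv.Perm (Fin a) | (DPCover.ofPerms G a σ).Colorable b}.ncard := by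
    rw [← Set.ncard_coe_finset]
    refine Set.ncard_le_ncard (fun σ hσ => ?_) (Set.toFinite _)
    obtain ⟨T, hT⟩ := (Finset.mem_filter.1 (Finset.mem_coe.1 hσ)).2
    exact hT.colorable
  have hadd := Finset.card_filter_add_card_filter_not (s := Finset.univ)
    fun σ : G.edgeSet → Equiv.Perm (Fin a) => ∃ T, IsPartialColoring e b (Fintype.card V) σ T
  rw [Finset.card_univ] at hadd
  have hadd' := congrArg (Nat.cast : ℕ → ℝ) hadd
  have hsub' := (Nat.cast_le (α := ℝ)).2 hsub
  push_cast at hadd'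
  linarith

theorem probColorable_le_one (G : SimpleGraph V) (a b : ℕ) : probColorable G a b ≤ 1 := by
  classical
  refine div_le_one_of_le₀ ?_ (Nat.cast_nonneg _)
  rw [Nat.cast_le, ← Set.ncard_univ]
  exact Set.ncard_le_ncard (Set.subset_univ _) (Set.toFinite _)

theorem probColorable_le_pStar (G : SimpleGraph V) {a b : ℕ} {k : ℝ} (hb : 0 < b)
    (hk : (a : ℝ) / b ≤ k) : probColorable G a b ≤ pStar G k := by
  refine le_csSup ⟨1, ?_⟩ ⟨a, b, hb, hk, rfl⟩
  rintro _ ⟨a, b, -, -, rfl⟩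
  exact probColorable_le_one G a b

/-! ### Fixed ratio, lists growing -/

theorem one_le_pStar_of_isDegenerate {d : ℕ} (hG : IsDegenerate G d) {x : ℚ} (hx : 1 ≤ x)
    (hgap : (x : ℝ)⁻¹ < (1 - (x : ℝ)⁻¹) ^ d) {k : ℝ} (hk : (x : ℝ) ≤ k) : 1 ≤ pStar G k := by
  set c : ℝ := (1 - (x : ℝ)⁻¹) ^ d - (x : ℝ)⁻¹ with hc
  have hc0 : 0 < c := sub_pos.2 hgap
  have hx0 : (0 : ℝ) < x := by exact_mod_cast lt_of_lt_of_le one_pos hx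
  set b₀ := x.den
  set a₀ := x.num.toNat with ha₀
  have hnum : 0 < x.num := Rat.num_pos.2 (lt_of_lt_of_le one_pos hx)
  have ha₀pos : 0 < a₀ := by omega
  have hb₀pos : 0 < b₀ := x.den_pos
  have hxeq : (x : ℝ) = a₀ / b₀ := by
    have h1 : ((a₀ : ℤ) : ℝ) = (x.num : ℝ) := by rw [ha₀, Int.toNat_of_nonneg hnum.le]
    rw [Int.cast_natCast] at h1
    rw [h1]
    exact Rat.cast_def x
  have hle : b₀ ≤ a₀ := by
    have h1 : (1 : ℝ) ≤ x := by exact_mod_cast hx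
    rw [hxeq, le_div_iff₀ (by exact_mod_cast hb₀pos), one_mul] at h1
    exact_mod_cast h1
  have ha₀R : (0 : ℝ) < a₀ := by exact_mod_cast ha₀pos
  have hb₀R : (0 : ℝ) < b₀ := by exact_mod_cast hb₀pos
  -- Scaling a₀ and b₀ by N + 1 keeps the ratio x and makes the gap (N + 1)a₀c, so a/gap² decays
  -- like 1/(N + 1).
  have hbound : ∀ N : ℕ, 1 - (Fintype.card V / (a₀ * c ^ 2)) / ((N : ℝ) + 1) ≤ pStar G k := by
    intro N
    have hN : (0 : ℝ) < (N : ℝ) + 1 := by positivity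
    have hq : (((((N + 1) * a₀ : ℕ) : ℝ) - ((N + 1) * b₀ : ℕ)) / ((N + 1) * a₀ : ℕ) : ℝ) =
        1 - (x : ℝ)⁻¹ := by
      rw [hxeq]; push_cast; field_simp
    have hdiff : (((N + 1) * a₀ : ℕ) : ℝ) * (1 - (x : ℝ)⁻¹) ^ d - ((N + 1) * b₀ : ℕ) =
        (N + 1) * a₀ * c := by
      rw [hc, hxeq]; push_cast; field_simp
    have h := one_sub_le_probColorable (G := G) (a := (N + 1) * a₀) (b := (N + 1) * b₀) (d := d)
      (by positivity) hG (Nat.mul_le_mul_left _ hle)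
      (by
        rw [hq, ← sub_pos, hdiff]
        positivity)
    rw [hq, hdiff] at h
    refine le_trans (le_of_eq ?_) (h.trans (probColorable_le_pStar G (by positivity)
      (le_trans (le_of_eq ?_) hk)))
    · push_cast
      field_simp
    · rw [hxeq]
      push_cast
      field_simp
  have hlim : Filter.Tendsto (fun N : ℕ => 1 - (Fintype.card V / (a₀ * c ^ 2)) / ((N : ℝ) + 1))
      Filter.atTop (nhds (1 - 0)) := by
    refine tendsto_const_nhds.sub ?_
    exact (tendsto_const_div_atTop_nhds_zero_nat (Fintype.card V / (a₀ * c ^ 2))).comp (Filter.tendsto_add_atTop_nat 1)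
      |>.congr fun N => by simp
  rw [sub_zero] at hlim
  exact le_of_tendsto' hlim hbound

end Greedy

/-! ### Choice of the ratio -/

theorem isDegenerate_degeneracy {V : Type*} [Fintype V] {G : SimpleGraph V}
    (h : 0 < degeneracy G) : IsDegenerate G (degeneracy G) :=
  Nat.sInf_mem (Nat.nonempty_of_pos_sInf h)

/-- Since 1 - 1/x = (1 + 1/(x - 1))⁻¹ ≥ exp(-1/(x - 1)), it suffices to compare exponents; this is
why x - 1 appears. -/
theorem inv_lt_one_sub_inv_pow {d : ℕ} {x : ℝ} (hx : 1 < x)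
    (h : d / (x - 1) < Real.log (x - 1)) : x⁻¹ < (1 - x⁻¹) ^ d := by
  have hr : 0 < x - 1 := by linarith
  have hx0 : 0 < x := by linarith
  have hbase : Real.exp (-(1 / (x - 1))) ≤ 1 - x⁻¹ := by
    rw [Real.exp_neg]
    have h1 : (1 - x⁻¹) = (1 / (x - 1) + 1)⁻¹ := by
      field_simp
      ring
    rw [h1]
    exact inv_anti₀ (by positivity) (Real.add_one_le_exp _)
  calc x⁻¹ < (x - 1)⁻¹ := inv_strictAnti₀ hr (by linarith)
    _ = Real.exp (-Real.log (x - 1)) := by rw [Real.exp_neg, Real.exp_log hr]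
    _ < Real.exp (-(d / (x - 1))) := Real.exp_lt_exp.2 (neg_lt_neg h)
    _ = Real.exp (-(1 / (x - 1))) ^ d := by
        rw [← Real.exp_nat_mul]
        congr 1
        ring
    _ ≤ (1 - x⁻¹) ^ d := pow_le_pow_left₀ (Real.exp_pos _).le hbase d

theorem eventually_exists_rat {ε : ℝ} (hε : 0 < ε) : ∀ᶠ t : ℝ in Filter.atTop,
    ∃ x : ℚ, 1 < x ∧ (x : ℝ) ≤ (1 + ε) * t / Real.log t ∧
      t / ((x : ℝ) - 1) < Real.log ((x : ℝ) - 1) := by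
  -- At x - 1 = (1 + ε/2)t/log t, the quotient t/(x - 1) is exactly s log t; s < 1 leaves room for
  -- t^s ≤ t/log t.
  set s : ℝ := (1 + ε / 2)⁻¹ with hs
  have hs0 : 0 < s := by positivity
  have hs1 : s < 1 := inv_lt_one_of_one_lt₀ (by linarith)
  have h1 := (isLittleO_log_rpow_atTop (sub_pos.2 hs1)).bound one_pos
  -- With log t ≤ (ε/4)t the slack (ε/2)t/log t exceeds 1, absorbing the shift from x - 1 to x.
  have h2 := (isLittleO_log_rpow_atTop one_pos).bound (show 0 < ε / 4 by positivity)
  filter_upwards [h1, h2, Filter.eventually_gt_atTop 1] with t h1 h2 ht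
  have ht0 : 0 < t := by linarith
  have hlog : 0 < Real.log t := Real.log_pos ht
  rw [Real.norm_of_nonneg hlog.le, Real.norm_of_nonneg (by positivity), one_mul] at h1
  rw [Real.norm_of_nonneg hlog.le, Real.norm_of_nonneg (by positivity), Real.rpow_one] at h2
  have hsmall : (1 + ε / 2) * t / Real.log t + 1 < (1 + ε) * t / Real.log t := by
    have : (1 + ε) * t / Real.log t = (1 + ε / 2) * t / Real.log t + (ε / 2) * t / Real.log t := by
      ring
    rw [this, add_lt_add_iff_left, lt_div_iff₀ hlog]
    nlinarith
  obtain ⟨x, hx1, hx2⟩ := exists_rat_btwn hsmall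
  have hpos : 0 < (1 + ε / 2) * t / Real.log t := by positivity
  have hr : (1 + ε / 2) * t / Real.log t < (x : ℝ) - 1 := by linarith
  refine ⟨x, by exact_mod_cast (show (1 : ℝ) < x by linarith), hx2.le, ?_⟩
  have hlow : t ^ s ≤ (x : ℝ) - 1 := by
    have : t ^ s ≤ t / Real.log t := by
      rw [le_div_iff₀ hlog]
      calc t ^ s * Real.log t ≤ t ^ s * t ^ (1 - s) := by gcongr
        _ = t := by rw [← Real.rpow_add ht0]; simp
    have h3 : t / Real.log t ≤ (1 + ε / 2) * t / Real.log t := by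
      gcongr
      nlinarith
    linarith
  calc t / ((x : ℝ) - 1) < t / ((1 + ε / 2) * t / Real.log t) :=
        div_lt_div_of_pos_left ht0 hpos hr
    _ = s * Real.log t := by
        rw [hs]
        field_simp
    _ = Real.log (t ^ s) := (Real.log_rpow ht0 s).symm
    _ ≤ Real.log ((x : ℝ) - 1) := Real.log_le_log (by positivity) hlow

theorem theorem1p8 :
    ∀ ε : ℝ, 0 < ε → ∃ d₀ : ℕ,
      ∀ (V : Type*) [Fintype V] [LinearOrder V] (G : SimpleGraph V) (d : ℕ),
        degeneracy G = d → d₀ ≤ d →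
        ∀ k : ℝ, (1 + ε) * d / Real.log d ≤ k →
          1 - ε ≤ pStar G k := by
  intro ε hε
  obtain ⟨d₁, hd₁⟩ := Filter.eventually_atTop.1
    (tendsto_natCast_atTop_atTop.eventually (eventually_exists_rat hε))
  -- The + 1 forces d > 0, which rules out the default value 0 of `sInf` on an empty set.
  refine ⟨d₁ + 1, fun V _ _ G d hG hd k hk => ?_⟩
  obtain ⟨x, hx1, hxk, hlog⟩ := hd₁ d (by omega)
  have hdeg : IsDegenerate G d := hG ▸ isDegenerate_degeneracy (by omega)
  have := one_le_pStar_of_isDegenerate hdeg hx1.le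
    (inv_lt_one_sub_inv_pow (by exact_mod_cast hx1) hlog) (hxk.trans hk)
  linarith
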